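/- Let $\mathcal F$ be a foliation of codimension $q$ of a smooth $m$-manifold $M$, given by an open cover $(U_i)$ of $M$, smooth submersions $f_i:U_i\to N_0$ with connected fibres onto open subsets of a $q$-manifold $N_0$, and local diffeomorphisms $k_{ij}$ of $N_0$ with $f_i=k_{ij}f_j$ on $U_i\cap U_j$. Let $T\mathcal F$ be the bundle of tangent spaces to the leaves ($T\mathcal F=\ker df_i$ on $U_i$), let $N=TM/T\mathcal F$ be the normal bundle, and write $\bar X$ for the section of $N$ defined by a vector field $X$. A vector field $X$ on an open set is an infinitesimal automorphism (i.a.) if $[X,Z]$ is tangent to the leaves for every local vector field $Z$ tangent to the leaves; a section of $N$ on an open set is foliated if it is locally of the form $\bar X$ with $X$ an i.a. All objects are smooth, and all conditions below are required for vector fields and sections on arbitrary open subsets of $M$. Let $g$ be a Riemannian metric in $N$ and let $D$ be a connection in $N$. The pair $(D,g)$ is a foliated Codazzi structure, and $(M,\mathcal F,D,g)$ a foliated Codazzi manifold, if - $D$ is torsion-free: $D_X\bar Y-D_Y\bar X=\overline{[X,Y]}$ for all vector fields $X,Y$; - $D$ is foliated: $D_X\sigma$ is a foliated section for every i.a. $X$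 and every foliated section $\sigma$; - $g$ is foliated: $X\,g(\sigma,\tau)=0$ for every $X$ tangent to the leaves and all foliated sections $\sigma,\tau$; - the Codazzi equation $(D_Xg)(\bar Y,Z)=(D_Yg)(\bar X,Z)$ holds for all i.a.s $X,Y$ and every foliated section $Z$, where $(D_Xg)(\sigma,\tau)=X\,g(\sigma,\tau)-g(D_X\sigma,\tau)-g(\sigma,D_X\tau)$. The dual connection of $D$ with respect to $g$ is the connection $D'$ in $N$ with $$X\,g(\bar Y,\bar Z)=g(D_X\bar Y,\bar Z)+g(\bar Y,D'_X\bar Z)\qquad\text{for all i.a.s }X,Y,Z.$$ The curvature of a connection $D$ in $N$ is $R_D(X,Y)Z=D_XD_YZ-D_YD_XZ-D_{[X,Y]}Z$ for vector fields $X,Y$ and a section $Z$ of $N$. For sections $X,Y$ of $N$ it is computed with vector fields representing them (the identities below are required, respectively asserted, for every choice of representatives). A foliated Codazzi structure $(D,g)$ has constant curvature $c\in\mathbb R$ if $R_D(X,Y)Z=c\,\bigl(g(Y,Z)X-g(X,Z)Y\bigr)$ for all sections $X,Y,Z$ of $N$. **Proposition.** Let $(M,\mathcal F,D,g)$ be a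 foliated Codazzi manifold, and let $D'$ be the dual connection of $D$ with respect to $g$. 1. For all sections $X,Y,Z,W$ of the normal bundle, $$g(R_D(X,Y)Z,W)+g(Z,R_{D'}(X,Y)W)=0 .$$ 2. For every $c\in\mathbb R$: if $(D,g)$ is a foliated Codazzi structure of constant curvature $c$, then $(D',g)$ is also a foliated Codazzi structure of constant curvature $c$. -/

import Mathlib

open scoped Manifold ContDiff

noncomputable section

/-- A (Haefliger) cocycle `{U_i, f_i, k_ij}` modelled on a `q`-manifold `N₀` and defining a foliation
of codimension `q` on the `m`-manifold `M`: the `U_i` are an open cover of `M`, the maps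
`f_i : U_i → N₀` are smooth submersions with connected fibres, and the `k_ij` are local
diffeomorphisms of `N₀` with `f_i = k_ij ∘ f_j` on `U_i ∩ U_j`.  The values of `f_i` outside `U_i`,
and of `k_ij` outside `f_j (U_i ∩ U_j)`, carry no information. -/
structure FoliationCocycle (m q : ℕ) (M : Type*) [TopologicalSpace M]
    [ChartedSpace (EuclideanSpace ℝ (Fin m)) M] (N₀ : Type*) [TopologicalSpace N₀]
    [ChartedSpace (EuclideanSpace ℝ (Fin q)) N₀] (ι : Type*) where
  /-- the open cover -/
  U : ι → Set M
  isOpen_U : ∀ i, IsOpen (U i)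
  cover : ∀ x, ∃ i, x ∈ U i
  /-- the local submersions -/
  f : ι → M → N₀
  submersion : ∀ i, ∀ x ∈ U i, Manifold.IsSubmersionAt (𝓡 m) (𝓡 q) ∞ (f i) x
  connected_fibres : ∀ i, ∀ y : N₀, IsPreconnected (U i ∩ f i ⁻¹' {y})
  /-- the transition maps -/
  k : ι → ι → N₀ → N₀
  localDiffeo : ∀ i j, ∀ x ∈ U i ∩ U j, IsLocalDiffeomorphAt (𝓡 q) (𝓡 q) ∞ (k i j) (f j x)
  transition : ∀ i j, ∀ x ∈ U i ∩ U j, f i x = k i j (f j x)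

namespace FoliationCocycle

variable {m q : ℕ} {M : Type*} [TopologicalSpace M] [ChartedSpace (EuclideanSpace ℝ (Fin m)) M]
  {N₀ : Type*} [TopologicalSpace N₀] [ChartedSpace (EuclideanSpace ℝ (Fin q)) N₀] {ι : Type*}

/-- The tangent space at `x` to the leaf through `x`: the kernel of the differential at `x` of the
local submersions `f_i` with `x ∈ U_i`.  These kernels coincide, see `tangent_eq_ker`. -/
def tangent (𝓕 : FoliationCocycle m q M N₀ ι) (x : M) : Submodule ℝ (TangentSpace (𝓡 m) x) :=
  ⨅ i : {i : ι // x ∈ 𝓕.U i}, LinearMap.ker (mfderiv (𝓡 m) (𝓡 q) (𝓕.f i) x).toLinearMap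

/-- Each local submersion defined at `x` computes the tangent space of the leaf. -/
theorem tangent_eq_ker (𝓕 : FoliationCocycle m q M N₀ ι) {x : M} {i : ι} (hi : x ∈ 𝓕.U i) :
    𝓕.tangent x = LinearMap.ker (mfderiv (𝓡 m) (𝓡 q) (𝓕.f i) x).toLinearMap := by
  refine le_antisymm (iInf_le _ (⟨i, hi⟩ : {i : ι // x ∈ 𝓕.U i})) (le_iInf ?_)
  rintro ⟨j, hj⟩ v hv
  have hfi : MDifferentiableAt (𝓡 m) (𝓡 q) (𝓕.f i) x :=
    (𝓕.submersion i x hi).contMDiffAt.mdifferentiableAt (by simp)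
  have hk : MDifferentiableAt (𝓡 q) (𝓡 q) (𝓕.k j i) (𝓕.f i x) :=
    (𝓕.localDiffeo j i x ⟨hj, hi⟩).contMDiffAt.mdifferentiableAt (by simp)
  have heq : 𝓕.f j =ᶠ[nhds x] 𝓕.k j i ∘ 𝓕.f i := by
    filter_upwards [((𝓕.isOpen_U j).inter (𝓕.isOpen_U i)).mem_nhds ⟨hj, hi⟩] with y hy
    exact 𝓕.transition j i y hy
  have hv' : mfderiv (𝓡 m) (𝓡 q) (𝓕.f i) x v = 0 := hv
  change mfderiv (𝓡 m) (𝓡 q) (𝓕.f j) x v = 0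
  have h1 := heq.mfderiv_eq (I := 𝓡 m) (I' := 𝓡 q)
  have h2 := mfderiv_comp x hk hfi
  have h3 : mfderiv (𝓡 m) (𝓡 q) (𝓕.k j i ∘ 𝓕.f i) x v = 0 := by
    rw [h2]
    exact (congrArg (mfderiv (𝓡 q) (𝓡 q) (𝓕.k j i) (𝓕.f i x)) hv').trans (map_zero _)
  have h4 : (mfderiv (𝓡 m) (𝓡 q) (𝓕.f j) x : EuclideanSpace ℝ (Fin m) →L[ℝ]
      EuclideanSpace ℝ (Fin q)) v = 0 :=
    (DFunLike.congr_fun (show (mfderiv (𝓡 m) (𝓡 q) (𝓕.f j) x : EuclideanSpace ℝ (Fin m) →L[ℝ]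
      EuclideanSpace ℝ (Fin q)) = mfderiv (𝓡 m) (𝓡 q) (𝓕.k j i ∘ 𝓕.f i) x from h1) v).trans h3
  exact h4

/-- The fibre at `x` of the normal bundle `N(M,𝓕) = TM / T𝓕`. -/
abbrev Normal (𝓕 : FoliationCocycle m q M N₀ ι) (x : M) : Type :=
  TangentSpace (𝓡 m) x ⧸ 𝓕.tangent x

/-- The section of the normal bundle defined by a vector field. -/
def proj (𝓕 : FoliationCocycle m q M N₀ ι) (X : Π x : M, TangentSpace (𝓡 m) x) :
    Π x : M, 𝓕.Normal x :=
  fun x ↦ (𝓕.tangent x).mkQ (X x)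

end FoliationCocycle

section

variable {m q : ℕ} {M : Type*} [TopologicalSpace M] [ChartedSpace (EuclideanSpace ℝ (Fin m)) M]
  [IsManifold (𝓡 m) ∞ M]
  {N₀ : Type*} [TopologicalSpace N₀] [ChartedSpace (EuclideanSpace ℝ (Fin q)) N₀] {ι : Type*}

/-- `X` restricts to a smooth vector field on `U`. -/
def IsSmoothField (U : Set M) (X : Π x : M, TangentSpace (𝓡 m) x) : Prop :=
  ContMDiffOn (𝓡 m) (𝓡 m).tangent ∞
    (fun x ↦ (⟨x, X x⟩ : TangentBundle (𝓡 m) M)) U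

namespace FoliationCocycle

variable (𝓕 : FoliationCocycle m q M N₀ ι)

/-- `σ` restricts to a smooth section of the normal bundle on `U`, that is, it is locally the class
of a smooth vector field. -/
def IsSmoothSection (U : Set M) (σ : Π x : M, 𝓕.Normal x) : Prop :=
  ∀ x ∈ U, ∃ V : Set M, IsOpen V ∧ x ∈ V ∧ V ⊆ U ∧
    ∃ Y : Π x : M, TangentSpace (𝓡 m) x, IsSmoothField V Y ∧ ∀ y ∈ V, σ y = 𝓕.proj Y y

/-- `X` is an infinitesimal automorphism of the foliation on `U`: it is smooth on `U` and its Lie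
bracket with every local vector field tangent to the leaves is tangent to the leaves. -/
def IsInfAut (U : Set M) (X : Π x : M, TangentSpace (𝓡 m) x) : Prop :=
  IsSmoothField U X ∧ ∀ V : Set M, IsOpen V → V ⊆ U → ∀ Z : Π x : M, TangentSpace (𝓡 m) x,
    IsSmoothField V Z → (∀ x ∈ V, Z x ∈ 𝓕.tangent x) →
      ∀ x ∈ V, VectorField.mlieBracket (𝓡 m) X Z x ∈ 𝓕.tangent x

/-- `σ` is a foliated section of the normal bundle on `U`: it is locally the class of an
infinitesimal automorphism. -/
def IsFoliatedSection (U : Set M) (σ : Π x : M, 𝓕.Normal x) : Prop :=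
  ∀ x ∈ U, ∃ V : Set M, IsOpen V ∧ x ∈ V ∧ V ⊆ U ∧
    ∃ Y : Π x : M, TangentSpace (𝓡 m) x, 𝓕.IsInfAut V Y ∧ ∀ y ∈ V, σ y = 𝓕.proj Y y

/-- A Riemannian metric in the normal bundle. -/
structure NormalMetric where
  /-- the scalar product in the fibre at `x` -/
  inner : Π x : M, 𝓕.Normal x →ₗ[ℝ] 𝓕.Normal x →ₗ[ℝ] ℝ
  symm : ∀ x v w, inner x v w = inner x w v
  pos : ∀ x v, v ≠ 0 → 0 < inner x v v
  smooth : ∀ U : Set M, IsOpen U → ∀ σ τ : Π x : M, 𝓕.Normal x,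
    𝓕.IsSmoothSection U σ → 𝓕.IsSmoothSection U τ →
      ContMDiffOn (𝓡 m) 𝓘(ℝ, ℝ) ∞ (fun x ↦ inner x (σ x) (τ x)) U

/-- A (smooth, linear) connection in the normal bundle.  `D σ x v` is `(D_v σ)(x)` for a tangent
vector `v` of `M` at `x` and a section `σ` which is smooth near `x`; the values on other sections
carry no information. -/
structure NormalConnection where
  /-- the covariant derivative -/
  toFun : (Π x : M, 𝓕.Normal x) → Π x : M, TangentSpace (𝓡 m) x →ₗ[ℝ] 𝓕.Normal x
  add : ∀ U : Set M, IsOpen U → ∀ σ τ : Π x : M, 𝓕.Normal x,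
    𝓕.IsSmoothSection U σ → 𝓕.IsSmoothSection U τ →
      ∀ x ∈ U, toFun (fun y ↦ σ y + τ y) x = toFun σ x + toFun τ x
  leibniz : ∀ U : Set M, IsOpen U → ∀ (φ : M → ℝ) (σ : Π x : M, 𝓕.Normal x),
    ContMDiffOn (𝓡 m) 𝓘(ℝ, ℝ) ∞ φ U → 𝓕.IsSmoothSection U σ →
      ∀ x ∈ U, ∀ v : TangentSpace (𝓡 m) x,
        toFun (fun y ↦ φ y • σ y) x v = φ x • toFun σ x v + mvfderiv (𝓡 m) φ x v • σ x
  smooth : ∀ U : Set M, IsOpen U →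
    ∀ (X : Π x : M, TangentSpace (𝓡 m) x) (σ : Π x : M, 𝓕.Normal x),
      IsSmoothField U X → 𝓕.IsSmoothSection U σ → 𝓕.IsSmoothSection U (fun x ↦ toFun σ x (X x))

variable {𝓕}

/-- The section `D_X σ`. -/
def NormalConnection.deriv (D : 𝓕.NormalConnection) (X : Π x : M, TangentSpace (𝓡 m) x)
    (σ : Π x : M, 𝓕.Normal x) : Π x : M, 𝓕.Normal x :=
  fun x ↦ D.toFun σ x (X x)

/-- The function `X g(σ, τ)`. -/
def NormalMetric.lieDeriv (g : 𝓕.NormalMetric) (X : Π x : M, TangentSpace (𝓡 m) x)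
    (σ τ : Π x : M, 𝓕.Normal x) (x : M) : ℝ :=
  mvfderiv (𝓡 m) (fun y ↦ g.inner y (σ y) (τ y)) x (X x)

/-- `D` is torsion-free: `D_X Y̅ - D_Y X̅` is the class of `[X, Y]`. -/
def NormalConnection.IsTorsionFree (D : 𝓕.NormalConnection) : Prop :=
  ∀ U : Set M, IsOpen U → ∀ X Y : Π x : M, TangentSpace (𝓡 m) x,
    IsSmoothField U X → IsSmoothField U Y → ∀ x ∈ U,
      D.deriv X (𝓕.proj Y) x - D.deriv Y (𝓕.proj X) x =
        𝓕.proj (VectorField.mlieBracket (𝓡 m) X Y) x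

/-- `D` is a foliated connection: `D_X σ` is a foliated section for every infinitesimal automorphism
`X` and every foliated section `σ`. -/
def NormalConnection.IsFoliated (D : 𝓕.NormalConnection) : Prop :=
  ∀ U : Set M, IsOpen U → ∀ (X : Π x : M, TangentSpace (𝓡 m) x) (σ : Π x : M, 𝓕.Normal x),
    𝓕.IsInfAut U X → 𝓕.IsFoliatedSection U σ → 𝓕.IsFoliatedSection U (D.deriv X σ)

/-- `g` is a foliated metric: `X g(σ, τ) = 0` for `X` tangent to the leaves and `σ`, `τ` foliated
sections. -/
def NormalMetric.IsFoliated (g : 𝓕.NormalMetric) : Prop :=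
  ∀ U : Set M, IsOpen U → ∀ (X : Π x : M, TangentSpace (𝓡 m) x) (σ τ : Π x : M, 𝓕.Normal x),
    IsSmoothField U X → (∀ x ∈ U, X x ∈ 𝓕.tangent x) →
      𝓕.IsFoliatedSection U σ → 𝓕.IsFoliatedSection U τ → ∀ x ∈ U, g.lieDeriv X σ τ x = 0

/-- The covariant derivative of the metric,
`(D_X g)(σ, τ) = X g(σ, τ) - g(D_X σ, τ) - g(σ, D_X τ)`. -/
def NormalConnection.derivMetric (D : 𝓕.NormalConnection) (g : 𝓕.NormalMetric)
    (X : Π x : M, TangentSpace (𝓡 m) x) (σ τ : Π x : M, 𝓕.Normal x) (x : M) : ℝ :=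
  g.lieDeriv X σ τ x - g.inner x (D.deriv X σ x) (τ x) - g.inner x (σ x) (D.deriv X τ x)

/-- The Codazzi equation `(D_X g)(Y̅, ζ) = (D_Y g)(X̅, ζ)`, for infinitesimal automorphisms `X`, `Y`
and foliated sections `ζ`. -/
def NormalConnection.SatisfiesCodazzi (D : 𝓕.NormalConnection) (g : 𝓕.NormalMetric) : Prop :=
  ∀ U : Set M, IsOpen U → ∀ (X Y : Π x : M, TangentSpace (𝓡 m) x) (ζ : Π x : M, 𝓕.Normal x),
    𝓕.IsInfAut U X → 𝓕.IsInfAut U Y → 𝓕.IsFoliatedSection U ζ → ∀ x ∈ U,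
      D.derivMetric g X (𝓕.proj Y) ζ x = D.derivMetric g Y (𝓕.proj X) ζ x

/-- `(D, g)` is a foliated Codazzi structure. -/
structure IsFoliatedCodazzi (D : 𝓕.NormalConnection) (g : 𝓕.NormalMetric) : Prop where
  torsionFree : D.IsTorsionFree
  codazzi : D.SatisfiesCodazzi g
  foliated_connection : D.IsFoliated
  foliated_metric : g.IsFoliated

/-- `D'` is the dual connection of `D` with respect to `g`:
`X g(Y̅, Z̅) = g(D_X Y̅, Z̅) + g(Y̅, D'_X Z̅)` for all infinitesimal automorphisms `X`, `Y`, `Z`. -/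
def IsDual (g : 𝓕.NormalMetric) (D D' : 𝓕.NormalConnection) : Prop :=
  ∀ U : Set M, IsOpen U → ∀ X Y Z : Π x : M, TangentSpace (𝓡 m) x,
    𝓕.IsInfAut U X → 𝓕.IsInfAut U Y → 𝓕.IsInfAut U Z → ∀ x ∈ U,
      g.lieDeriv X (𝓕.proj Y) (𝓕.proj Z) x =
        g.inner x (D.deriv X (𝓕.proj Y) x) (𝓕.proj Z x) +
          g.inner x (𝓕.proj Y x) (D'.deriv X (𝓕.proj Z) x)

/-- The curvature `R_D(X, Y)σ = D_X D_Y σ - D_Y D_X σ - D_{[X, Y]} σ`. -/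
def NormalConnection.curvature (D : 𝓕.NormalConnection) (X Y : Π x : M, TangentSpace (𝓡 m) x)
    (σ : Π x : M, 𝓕.Normal x) (x : M) : 𝓕.Normal x :=
  D.deriv X (D.deriv Y σ) x - D.deriv Y (D.deriv X σ) x
    - D.deriv (VectorField.mlieBracket (𝓡 m) X Y) σ x

/-- `R_D(ξ, η)ζ = c (g(η, ζ) ξ - g(ξ, ζ) η)` for all sections `ξ`, `η`, `ζ` of the normal bundle.
The sections `ξ`, `η` enter through vector fields `X`, `Y` representing them. -/
def HasConstantCurvature (D : 𝓕.NormalConnection) (g : 𝓕.NormalMetric) (c : ℝ) : Prop :=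
  ∀ U : Set M, IsOpen U → ∀ (X Y : Π x : M, TangentSpace (𝓡 m) x) (ζ : Π x : M, 𝓕.Normal x),
    IsSmoothField U X → IsSmoothField U Y → 𝓕.IsSmoothSection U ζ → ∀ x ∈ U,
      D.curvature X Y ζ x =
        c • (g.inner x (𝓕.proj Y x) (ζ x) • 𝓕.proj X x - g.inner x (𝓕.proj X x) (ζ x) • 𝓕.proj Y x)

end FoliationCocycle

end

end

/-! The duality relation is given only for infinitesimal automorphisms. In a submersion chart the
pulled-back constant fields are infinitesimal automorphisms through every tangent vector, and their
classes generate the smooth sections of the normal bundle over the smooth functions. Additivity and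
the Leibniz rule therefore extend duality to all smooth sections and tangent vectors
(`IsDual.mvfderiv_inner`).

Part 1: apply `[X, Y]` to `g(Z, W)` as the commutator of `X` and `Y`. Expanding the second
derivatives by duality, the mixed terms are symmetric in `X`, `Y` and cancel; the two curvatures
remain (`IsDual.inner_curvature_add`).

Part 2: put `S = D' - D`. Then `(D_X g)(σ, τ) = g(S_X σ, τ)`, so `S` is tensorial and Codazzi says
that `S_X Y̅` is symmetric in `X`, `Y`. Hence `D'` has the torsion of `D`, and `D'g = -Dg` is again
Codazzi. Also `g(D'_X σ, ζ) = X g(σ, ζ) - g(σ, D_X ζ)` is constant along the leaves for foliated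
`σ`, `ζ`, and a section with this property is foliated because `g` is foliated and nondegenerate
(`NormalMetric.IsFoliated.isFoliatedSection`). Constant curvature passes to `D'` by Part 1, the
model tensor being skew for `g`. -/

noncomputable section

/-! ### The Lie bracket as the commutator of derivations on a manifold. -/

section
variable {E H M F : Type*} [NormedAddCommGroup E] [NormedSpace ℝ E] [TopologicalSpace H]
  {I : ModelWithCorners ℝ E H} [TopologicalSpace M] [ChartedSpace H M]
  [NormedAddCommGroup F] [NormedSpace ℝ F]

theorem Filter.EventuallyEq.mvfderiv_eq {f g : M → F} {x : M} (h : f =ᶠ[nhds x] g) :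
    mvfderiv I f x = mvfderiv I g x := by
  ext v
  exact DFunLike.congr_fun (show (mfderiv I 𝓘(ℝ, F) f x : E →L[ℝ] F) = mfderiv I 𝓘(ℝ, F) g x from
    h.mfderiv_eq) v

theorem mvfderiv_comp_apply_of_mdifferentiableAt {E' H' M' : Type*} [NormedAddCommGroup E']
    [NormedSpace ℝ E'] [TopologicalSpace H'] {I' : ModelWithCorners ℝ E' H'} [TopologicalSpace M']
    [ChartedSpace H' M'] {f : M → M'} {g : M' → F} {x : M}
    (hg : MDifferentiableAt I' 𝓘(ℝ, F) g (f x)) (hf : MDifferentiableAt I I' f x)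
    (v : TangentSpace I x) :
    mvfderiv I (g ∘ f) x v = mvfderiv I' g (f x) (mfderiv I I' f x v) :=
  mfderiv_comp_apply x hg hf v

theorem mvfderiv_vectorSpace_apply (f : E → F) (x v : E) :
    mvfderiv 𝓘(ℝ, E) f x v = fderiv ℝ f x v :=
  DFunLike.congr_fun (mfderiv_eq_fderiv (𝕜 := ℝ) (f := f) (x := x)) v

theorem ContMDiffAt.mvfderiv_apply_vectorField [IsManifold I ∞ M] {f : M → F}
    {X : Π x : M, TangentSpace I x} {x : M} (hf : ContMDiffAt I 𝓘(ℝ, F) ∞ f x)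
    (hX : ContMDiffAt I I.tangent ∞ (fun y ↦ (⟨y, X y⟩ : TangentBundle I M)) x) :
    ContMDiffAt I 𝓘(ℝ, F) ∞ (fun y ↦ mvfderiv I f y (X y)) x := by
  have : IsManifold I 1 M := IsManifold.of_le (n := ∞) (by simp)
  have h := ContMDiffAt.clm_apply_of_inCoordinates (hf.mfderiv_const (m := ∞) (by simp)) hX hf
  exact (contMDiff_snd_tangentBundle_modelSpace F 𝓘(ℝ, F)).contMDiffAt.comp x h

/-- Pulling back along `ψ` reduces the identity to `VectorField.fderiv_apply_lieBracket` on `E`.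
Invertibility is required near `z`, not just at `z`, because the pulled-back first derivatives are
differentiated again. -/
theorem mvfderiv_mlieBracket_apply_of_parametrization [CompleteSpace E] [IsManifold I ∞ M]
    {f : M → F} {X Y : Π x : M, TangentSpace I x} {ψ : E → M} {z : E}
    (hψ : ContMDiffAt 𝓘(ℝ, E) I ∞ ψ z)
    (hψ' : ∀ᶠ w in nhds z, (mfderiv 𝓘(ℝ, E) I ψ w).IsInvertible)
    (hf : ContMDiffAt I 𝓘(ℝ, F) ∞ f (ψ z))
    (hX : ContMDiffAt I I.tangent ∞ (fun y ↦ (⟨y, X y⟩ : TangentBundle I M)) (ψ z))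
    (hY : ContMDiffAt I I.tangent ∞ (fun y ↦ (⟨y, Y y⟩ : TangentBundle I M)) (ψ z)) :
    mvfderiv I f (ψ z) (VectorField.mlieBracket I X Y (ψ z)) =
      mvfderiv I (fun y ↦ mvfderiv I f y (Y y)) (ψ z) (X (ψ z)) -
        mvfderiv I (fun y ↦ mvfderiv I f y (X y)) (ψ z) (Y (ψ z)) := by
  have : IsManifold I (minSmoothness ℝ 3) M := IsManifold.of_le (n := ∞) (by simpa using ENat.LEInfty.out)
  have hψd : ∀ᶠ w in nhds z, MDifferentiableAt 𝓘(ℝ, E) I ψ w := by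
    filter_upwards [(contMDiffAt_iff_contMDiffAt_nhds (by simp)).1
      (hψ.of_le (m := 1) (by simp))] with w hw using hw.mdifferentiableAt (by simp)
  have hfd : ∀ᶠ w in nhds z, MDifferentiableAt I 𝓘(ℝ, F) f (ψ w) :=
    hψ.continuousAt.eventually (by
      filter_upwards [(contMDiffAt_iff_contMDiffAt_nhds (by simp)).1
        (hf.of_le (m := 1) (by simp))] with w hw using hw.mdifferentiableAt (by simp))
  let P (W : Π x : M, TangentSpace I x) : E → E := VectorField.mpullback 𝓘(ℝ, E) I ψ W
  have pull : ∀ (W : Π x : M, TangentSpace I x) (w : E), (mfderiv 𝓘(ℝ, E) I ψ w).IsInvertible →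
      mfderiv 𝓘(ℝ, E) I ψ w (P W w) = W (ψ w) :=
    fun W w hw ↦ hw.self_apply_inverse _
  have deriv_comp : ∀ (h : M → F) (w v : E), MDifferentiableAt I 𝓘(ℝ, F) h (ψ w) →
      MDifferentiableAt 𝓘(ℝ, E) I ψ w →
      fderiv ℝ (h ∘ ψ) w v = mvfderiv I h (ψ w) (mfderiv 𝓘(ℝ, E) I ψ w v) := fun h w v h1 h2 ↦
    (mvfderiv_vectorSpace_apply (h ∘ ψ) w v).symm.trans
      (mvfderiv_comp_apply_of_mdifferentiableAt h1 h2 v)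
  have deriv_pull : ∀ W : Π x : M, TangentSpace I x,
      (fun w ↦ fderiv ℝ (f ∘ ψ) w (P W w)) =ᶠ[nhds z] (fun y ↦ mvfderiv I f y (W y)) ∘ ψ := by
    intro W
    filter_upwards [hψd, hfd, hψ'] with w h1 h2 h3
    exact (deriv_comp f w _ h2 h1).trans (congrArg _ (pull W w h3))
  have second : ∀ V W : Π x : M, TangentSpace I x,
      ContMDiffAt I I.tangent ∞ (fun y ↦ (⟨y, W y⟩ : TangentBundle I M)) (ψ z) →
      fderiv ℝ (fun w ↦ fderiv ℝ (f ∘ ψ) w (P W w)) z (P V z) =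
        mvfderiv I (fun y ↦ mvfderiv I f y (W y)) (ψ z) (V (ψ z)) := by
    intro V W hW
    rw [(deriv_pull W).fderiv_eq]
    exact (deriv_comp _ z _ ((hf.mvfderiv_apply_vectorField hW).mdifferentiableAt (by simp))
      hψd.self_of_nhds).trans (congrArg _ (pull V z hψ'.self_of_nhds))
  have diff : ∀ W : Π x : M, TangentSpace I x,
      ContMDiffAt I I.tangent ∞ (fun y ↦ (⟨y, W y⟩ : TangentBundle I M)) (ψ z) →
      DifferentiableAt ℝ (P W) z := by
    intro W hW
    have h : ContMDiffAt 𝓘(ℝ, E) 𝓘(ℝ, E).tangent ∞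
        (fun w ↦ (⟨w, VectorField.mpullback 𝓘(ℝ, E) I ψ W w⟩ : TangentBundle 𝓘(ℝ, E) E)) z :=
      ContMDiffAt.mpullback_vectorField_preimage (n := ∞) hW hψ hψ'.self_of_nhds (by simp)
    exact (contMDiffAt_vectorSpace_iff_contDiffAt.1 h).differentiableAt (by simp)
  have key := VectorField.fderiv_apply_lieBracket (f := f ∘ ψ) (n := ∞)
    (contMDiffAt_iff_contDiffAt.1 (hf.comp z hψ)) (by simpa using ENat.LEInfty.out)
    (diff Y hY) (diff X hX)
  rw [second X Y hY, second Y X hX] at key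
  have hb : P (VectorField.mlieBracket I X Y) z = VectorField.lieBracket ℝ (P X) (P Y) z := by
    have h := VectorField.mpullback_mlieBracket (n := ∞) (hX.mdifferentiableAt (by simp))
      (hY.mdifferentiableAt (by simp)) hψ (by simpa using ENat.LEInfty.out)
    rw [← VectorField.lieBracketWithin_univ]
    exact h.trans (congrFun (VectorField.mlieBracketWithin_eq_lieBracketWithin (s := Set.univ)) z)
  rw [← key, ← hb, deriv_comp f z _ hfd.self_of_nhds hψd.self_of_nhds,
    pull _ z hψ'.self_of_nhds]

theorem mvfderiv_mlieBracket_apply [CompleteSpace E] [I.Boundaryless] [IsManifold I ∞ M] {f : M → F}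
    {X Y : Π x : M, TangentSpace I x} {x : M} (hf : ContMDiffAt I 𝓘(ℝ, F) ∞ f x)
    (hX : ContMDiffAt I I.tangent ∞ (fun y ↦ (⟨y, X y⟩ : TangentBundle I M)) x)
    (hY : ContMDiffAt I I.tangent ∞ (fun y ↦ (⟨y, Y y⟩ : TangentBundle I M)) x) :
    mvfderiv I f x (VectorField.mlieBracket I X Y x) =
      mvfderiv I (fun y ↦ mvfderiv I f y (Y y)) x (X x) -
        mvfderiv I (fun y ↦ mvfderiv I f y (X y)) x (Y x) := by
  have h1 : IsManifold I 1 M := IsManifold.of_le (n := ∞) (by simp)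
  obtain ⟨ψ, z, hψ, hψ', rfl⟩ : ∃ (ψ : E → M) (z : E), ContMDiffAt 𝓘(ℝ, E) I ∞ ψ z ∧
      (∀ᶠ w in nhds z, (mfderiv 𝓘(ℝ, E) I ψ w).IsInvertible) ∧ ψ z = x := by
    refine ⟨(extChartAt I x).symm, extChartAt I x x, ?_, ?_, extChartAt_to_inv x⟩
    · exact (contMDiffOn_extChartAt_symm x).contMDiffAt (extChartAt_target_mem_nhds x)
    · filter_upwards [extChartAt_target_mem_nhds (I := I) x] with w hw
      have := isInvertible_mfderivWithin_extChartAt_symm hw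
      -- Without boundary the model has full range, so the derivative within the range is the full
      -- derivative.
      rwa [I.range_eq_univ, mfderivWithin_univ] at this
  exact mvfderiv_mlieBracket_apply_of_parametrization hψ hψ' hf hX hY

end

/-! ### Adapted frames: local fields that trivialize the foliation. -/

section

variable {m q : ℕ} {M : Type*} [TopologicalSpace M] [ChartedSpace (EuclideanSpace ℝ (Fin m)) M]
  [IsManifold (𝓡 m) ∞ M]
  {N₀ : Type*} [TopologicalSpace N₀] [ChartedSpace (EuclideanSpace ℝ (Fin q)) N₀] {ι : Type*}

theorem IsSmoothField.mono {U V : Set M} {X : Π x : M, TangentSpace (𝓡 m) x}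
    (hX : IsSmoothField U X) (h : V ⊆ U) : IsSmoothField V X :=
  ContMDiffOn.mono hX h

theorem IsSmoothField.contMDiffAt {U : Set M} {X : Π x : M, TangentSpace (𝓡 m) x}
    (hX : IsSmoothField U X) (hU : IsOpen U) {x : M} (hx : x ∈ U) :
    ContMDiffAt (𝓡 m) (𝓡 m).tangent ∞ (fun y ↦ (⟨y, X y⟩ : TangentBundle (𝓡 m) M)) x :=
  ContMDiffOn.contMDiffAt hX (hU.mem_nhds hx)

theorem IsSmoothField.add {U : Set M} {X Y : Π x : M, TangentSpace (𝓡 m) x}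
    (hX : IsSmoothField U X) (hY : IsSmoothField U Y) : IsSmoothField U (fun x ↦ X x + Y x) :=
  ContMDiffOn.add_section hX hY

theorem IsSmoothField.smul {U : Set M} {φ : M → ℝ} {X : Π x : M, TangentSpace (𝓡 m) x}
    (hφ : ContMDiffOn (𝓡 m) 𝓘(ℝ, ℝ) ∞ φ U) (hX : IsSmoothField U X) :
    IsSmoothField U (fun x ↦ φ x • X x) :=
  ContMDiffOn.smul_section hφ hX

theorem IsSmoothField.contMDiffOn_mvfderiv {F : Type*} [NormedAddCommGroup F] [NormedSpace ℝ F]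
    {U : Set M} (hU : IsOpen U) {X : Π x : M, TangentSpace (𝓡 m) x} (hX : IsSmoothField U X)
    {f : M → F} (hf : ContMDiffOn (𝓡 m) 𝓘(ℝ, F) ∞ f U) :
    ContMDiffOn (𝓡 m) 𝓘(ℝ, F) ∞ (fun y ↦ mvfderiv (𝓡 m) f y (X y)) U := fun _ hx ↦
  ((hf.contMDiffAt (hU.mem_nhds hx)).mvfderiv_apply_vectorField
    (hX.contMDiffAt hU hx)).contMDiffWithinAt

namespace FoliationCocycle

variable (𝓕 : FoliationCocycle m q M N₀ ι)

/-- A submersion `h` onto the transverse model whose fibres are the plaques of `V`, together with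
vector fields which span the tangent spaces of `V` and along which `h` has constant derivative. -/
structure AdaptedFrame (V : Set M) where
  /-- the transverse coordinates -/
  h : M → EuclideanSpace ℝ (Fin q)
  contMDiffOn_h : ContMDiffOn (𝓡 m) 𝓘(ℝ, EuclideanSpace ℝ (Fin q)) ∞ h V
  mem_tangent_iff : ∀ y ∈ V, ∀ v : TangentSpace (𝓡 m) y,
    v ∈ 𝓕.tangent y ↔ mvfderiv (𝓡 m) h y v = 0
  /-- the vector fields of the frame -/
  field : EuclideanSpace ℝ (Fin m) → Π x : M, TangentSpace (𝓡 m) x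
  isSmoothField_field : ∀ v, IsSmoothField V (field v)
  /-- the derivative of `h` along the vector fields of the frame -/
  slope : EuclideanSpace ℝ (Fin m) → EuclideanSpace ℝ (Fin q)
  slope_surjective : Function.Surjective slope
  mvfderiv_field : ∀ v, ∀ y ∈ V, mvfderiv (𝓡 m) h y (field v y) = slope v
  exists_field_eq : ∀ y ∈ V, ∀ w : TangentSpace (𝓡 m) y, ∃ v, field v y = w

variable {𝓕} in
/-- The restriction of an adapted frame to a smaller set. -/
def AdaptedFrame.restrict {V W : Set M} (A : 𝓕.AdaptedFrame V) (hW : W ⊆ V) :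
    𝓕.AdaptedFrame W where
  h := A.h
  contMDiffOn_h := A.contMDiffOn_h.mono hW
  mem_tangent_iff y hy := A.mem_tangent_iff y (hW hy)
  field := A.field
  isSmoothField_field v := (A.isSmoothField_field v).mono hW
  slope := A.slope
  slope_surjective := A.slope_surjective
  mvfderiv_field v y hy := A.mvfderiv_field v y (hW hy)
  exists_field_eq y hy := A.exists_field_eq y (hW hy)

/-- In the charts of the local normal form of a submersion, `f i` becomes a linear surjection `π`.
The transverse coordinates are `π ∘ φ`, and the frame consists of the constant fields pulled back by
`φ`; their slopes are the constants `π v`. -/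
theorem exists_adaptedFrame [IsManifold (𝓡 q) ∞ N₀] (x : M) :
    ∃ V : Set M, IsOpen V ∧ x ∈ V ∧ Nonempty (𝓕.AdaptedFrame V) := by
  obtain ⟨i, hi⟩ := 𝓕.cover x
  have hs := 𝓕.submersion i x hi
  have h1M : IsManifold (𝓡 m) 1 M := IsManifold.of_le (n := ∞) (by simp)
  have h1N : IsManifold (𝓡 q) 1 N₀ := IsManifold.of_le (n := ∞) (by simp)
  set φ := hs.domChart with hφ
  set ψ := hs.codChart with hψ
  have hφa : φ ∈ IsManifold.maximalAtlas (𝓡 m) ∞ M := hs.domChart_mem_maximalAtlas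
  have hψa : ψ ∈ IsManifold.maximalAtlas (𝓡 q) ∞ N₀ := hs.codChart_mem_maximalAtlas
  have hφs : ∀ y ∈ φ.source, ContMDiffAt (𝓡 m) (𝓡 m) ∞ φ y := fun y hy ↦
    contMDiffAt_of_mem_maximalAtlas hφa hy
  have hψs : ∀ y ∈ ψ.source, ContMDiffAt (𝓡 q) (𝓡 q) ∞ ψ y := fun y hy ↦
    contMDiffAt_of_mem_maximalAtlas hψa hy
  have hφd : φ.MDifferentiable (𝓡 m) (𝓡 m) :=
    ⟨(contMDiffOn_of_mem_maximalAtlas hφa).mdifferentiableOn (by simp),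
      (contMDiffOn_symm_of_mem_maximalAtlas hφa).mdifferentiableOn (by simp)⟩
  have hψd : ψ.MDifferentiable (𝓡 q) (𝓡 q) :=
    ⟨(contMDiffOn_of_mem_maximalAtlas hψa).mdifferentiableOn (by simp),
      (contMDiffOn_symm_of_mem_maximalAtlas hψa).mdifferentiableOn (by simp)⟩
  let π : EuclideanSpace ℝ (Fin m) →L[ℝ] EuclideanSpace ℝ (Fin q) :=
    (ContinuousLinearMap.fst ℝ _ _).comp hs.equiv.toContinuousLinearMap
  have hπ : Function.Surjective π := fun w ↦ ⟨hs.equiv.symm (w, 0), by simp [π]⟩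
  have hloc : ∀ y ∈ φ.source, ψ (𝓕.f i y) = π (φ y) := by
    intro y hy
    have hmem : φ y ∈ (hs.domChart.extend (𝓡 m)).target := by
      simpa using φ.map_source hy
    have h := hs.writtenInCharts hmem
    simpa [π, hφ, hψ, hs.domChart.left_inv hy] using h
  have hinv : ∀ y ∈ φ.source, (mfderiv (𝓡 m) (𝓡 m) φ y).IsInvertible := fun y hy ↦
    ⟨hφd.mfderiv hy, rfl⟩
  have hd : ∀ y ∈ φ.source, ∀ v : TangentSpace (𝓡 m) y,
      mvfderiv (𝓡 m) (π ∘ φ) y v = π (mfderiv (𝓡 m) (𝓡 m) φ y v) := by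
    intro y hy v
    rw [mvfderiv_comp_apply_of_mdifferentiableAt (I' := 𝓡 m)
      (π.contMDiff.contMDiffAt.mdifferentiableAt one_ne_zero) (hφd.mdifferentiableAt hy)]
    exact (mvfderiv_vectorSpace_apply π _ _).trans (by rw [π.fderiv])
  refine ⟨φ.source ∩ 𝓕.U i, φ.open_source.inter (𝓕.isOpen_U i), ⟨hs.mem_domChart_source, hi⟩, ⟨{
    h := π ∘ φ
    contMDiffOn_h := fun y hy ↦
      (π.contMDiff.contMDiffAt.comp y (hφs y hy.1)).contMDiffWithinAt
    mem_tangent_iff := ?_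
    field := fun v ↦ VectorField.mpullback (𝓡 m) (𝓡 m) φ (fun _ ↦ v)
    isSmoothField_field := ?_
    slope := π
    slope_surjective := hπ
    mvfderiv_field := ?_
    exists_field_eq := ?_ }⟩⟩
  · intro y hy v
    rw [𝓕.tangent_eq_ker hy.2]
    have hf : MDifferentiableAt (𝓡 m) (𝓡 q) (𝓕.f i) y :=
      (𝓕.submersion i y hy.2).contMDiffAt.mdifferentiableAt (by simp)
    have hψy : 𝓕.f i y ∈ ψ.source := hs.source_subset_preimage_source hy.1
    -- The chart `ψ` has injective derivative, so composing with it does not change the kernel of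
    -- the derivative of `f i`.
    have heq : π ∘ φ =ᶠ[nhds y] ψ ∘ 𝓕.f i := by
      filter_upwards [φ.open_source.mem_nhds hy.1] with z hz using (hloc z hz).symm
    have hchain : mvfderiv (𝓡 m) (π ∘ φ) y v =
        mfderiv (𝓡 q) (𝓡 q) ψ (𝓕.f i y) (mfderiv (𝓡 m) (𝓡 q) (𝓕.f i) y v) := by
      rw [heq.mvfderiv_eq]
      exact mfderiv_comp_apply y (hψd.mdifferentiableAt hψy) hf v
    rw [hchain]
    exact ((map_eq_zero_iff _ (hψd.mfderiv_injective hψy))).symm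
  · intro v y hy
    exact (ContMDiffAt.mpullback_vectorField_preimage (n := ∞)
      (contMDiffAt_vectorSpace_iff_contDiffAt.2 contDiffAt_const)
      (hφs y hy.1) (hinv y hy.1) (by simp)).contMDiffWithinAt
  · intro v y hy
    rw [hd y hy.1]
    exact congrArg π ((hinv y hy.1).self_apply_inverse _)
  · intro y hy w
    refine ⟨mfderiv (𝓡 m) (𝓡 m) φ y w, ?_⟩
    exact (hinv y hy.1).inverse_apply_self _

end FoliationCocycle
end

/-! ### Infinitesimal automorphisms generate the normal bundle locally. -/

section

variable {m q : ℕ} {M : Type*} [TopologicalSpace M] [ChartedSpace (EuclideanSpace ℝ (Fin m)) M]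
  [IsManifold (𝓡 m) ∞ M]
  {N₀ : Type*} [TopologicalSpace N₀] [ChartedSpace (EuclideanSpace ℝ (Fin q)) N₀] {ι : Type*}

namespace FoliationCocycle

variable {𝓕 : FoliationCocycle m q M N₀ ι}

theorem IsSmoothSection.mono {U V : Set M} {σ : Π x : M, 𝓕.Normal x}
    (hσ : 𝓕.IsSmoothSection U σ) (hV : IsOpen V) (h : V ⊆ U) : 𝓕.IsSmoothSection V σ := by
  intro x hx
  obtain ⟨W, hW, hxW, -, Y, hY, hσY⟩ := hσ x (h hx)
  exact ⟨W ∩ V, hW.inter hV, ⟨hxW, hx⟩, Set.inter_subset_right, Y,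
    hY.mono Set.inter_subset_left, fun y hy ↦ hσY y hy.1⟩

theorem IsSmoothSection.congr {U : Set M} {σ τ : Π x : M, 𝓕.Normal x}
    (hσ : 𝓕.IsSmoothSection U σ) (h : ∀ x ∈ U, τ x = σ x) : 𝓕.IsSmoothSection U τ := by
  intro x hx
  obtain ⟨W, hW, hxW, hWU, Y, hY, hσY⟩ := hσ x hx
  exact ⟨W, hW, hxW, hWU, Y, hY, fun y hy ↦ (h y (hWU hy)).trans (hσY y hy)⟩

theorem IsSmoothSection.add {U : Set M} {σ τ : Π x : M, 𝓕.Normal x}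
    (hσ : 𝓕.IsSmoothSection U σ) (hτ : 𝓕.IsSmoothSection U τ) :
    𝓕.IsSmoothSection U (fun x ↦ σ x + τ x) := by
  intro x hx
  obtain ⟨V, hV, hxV, hVU, Y, hY, hσY⟩ := hσ x hx
  obtain ⟨W, hW, hxW, hWU, Z, hZ, hτZ⟩ := hτ x hx
  refine ⟨V ∩ W, hV.inter hW, ⟨hxV, hxW⟩, Set.inter_subset_left.trans hVU,
    fun y ↦ Y y + Z y, (hY.mono Set.inter_subset_left).add (hZ.mono Set.inter_subset_right),
    fun y hy ↦ ?_⟩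
  beta_reduce
  rw [hσY y hy.1, hτZ y hy.2]
  exact (map_add _ _ _).symm

theorem IsSmoothSection.smul {U : Set M} {φ : M → ℝ} {σ : Π x : M, 𝓕.Normal x}
    (hφ : ContMDiffOn (𝓡 m) 𝓘(ℝ, ℝ) ∞ φ U) (hσ : 𝓕.IsSmoothSection U σ) :
    𝓕.IsSmoothSection U (fun x ↦ φ x • σ x) := by
  intro x hx
  obtain ⟨V, hV, hxV, hVU, Y, hY, hσY⟩ := hσ x hx
  refine ⟨V, hV, hxV, hVU, fun y ↦ φ y • Y y, hY.smul (hφ.mono hVU), fun y hy ↦ ?_⟩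
  beta_reduce
  rw [hσY y hy]
  exact (map_smul _ _ _).symm

theorem isSmoothSection_proj {U : Set M} (hU : IsOpen U) {X : Π x : M, TangentSpace (𝓡 m) x}
    (hX : IsSmoothField U X) : 𝓕.IsSmoothSection U (𝓕.proj X) :=
  fun _ hx ↦ ⟨U, hU, hx, subset_rfl, X, hX, fun _ _ ↦ rfl⟩

theorem IsInfAut.mono {U V : Set M} {X : Π x : M, TangentSpace (𝓡 m) x}
    (hX : 𝓕.IsInfAut U X) (h : V ⊆ U) : 𝓕.IsInfAut V X :=
  ⟨hX.1.mono h, fun W hW hWV ↦ hX.2 W hW (hWV.trans h)⟩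

theorem IsInfAut.isFoliatedSection {U : Set M} (hU : IsOpen U)
    {X : Π x : M, TangentSpace (𝓡 m) x} (hX : 𝓕.IsInfAut U X) :
    𝓕.IsFoliatedSection U (𝓕.proj X) :=
  fun _ hx ↦ ⟨U, hU, hx, subset_rfl, X, hX, fun _ _ ↦ rfl⟩

theorem IsFoliatedSection.isSmoothSection {U : Set M} {σ : Π x : M, 𝓕.Normal x}
    (hσ : 𝓕.IsFoliatedSection U σ) : 𝓕.IsSmoothSection U σ := by
  intro x hx
  obtain ⟨V, hV, hxV, hVU, Y, hY, hσY⟩ := hσ x hx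
  exact ⟨V, hV, hxV, hVU, Y, hY.1, hσY⟩

theorem IsFoliatedSection.mono {U V : Set M} {σ : Π x : M, 𝓕.Normal x}
    (hσ : 𝓕.IsFoliatedSection U σ) (hV : IsOpen V) (h : V ⊆ U) : 𝓕.IsFoliatedSection V σ := by
  intro x hx
  obtain ⟨W, hW, hxW, -, Y, hY, hσY⟩ := hσ x (h hx)
  exact ⟨W ∩ V, hW.inter hV, ⟨hxW, hx⟩, Set.inter_subset_right, Y,
    hY.mono Set.inter_subset_left, fun y hy ↦ hσY y hy.1⟩

namespace AdaptedFrame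

variable {V : Set M} (A : 𝓕.AdaptedFrame V)

/-- A vector field is an infinitesimal automorphism if its derivatives of the transverse
coordinates are constant along the leaves. -/
theorem isInfAut (hV : IsOpen V) {Y : Π x : M, TangentSpace (𝓡 m) x} (hY : IsSmoothField V Y)
    (h : ∀ x ∈ V, ∀ v ∈ 𝓕.tangent x,
      mvfderiv (𝓡 m) (fun y ↦ mvfderiv (𝓡 m) A.h y (Y y)) x v = 0) : 𝓕.IsInfAut V Y := by
  refine ⟨hY, fun W hW hWV Z hZ hZt x hx ↦ ?_⟩
  have hZ0 : (fun y ↦ mvfderiv (𝓡 m) A.h y (Z y)) =ᶠ[nhds x] fun _ ↦ 0 := by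
    filter_upwards [hW.mem_nhds hx] with y hy
      using (A.mem_tangent_iff y (hWV hy) _).1 (hZt y hy)
  -- Here `[Y, Z]h = Y(Zh) - Z(Yh)`: the first term vanishes since `Zh = 0` near `x`, the second by
  -- `h`.
  rw [A.mem_tangent_iff x (hWV hx), mvfderiv_mlieBracket_apply
    (A.contMDiffOn_h.contMDiffAt (hV.mem_nhds (hWV hx))) (hY.contMDiffAt hV (hWV hx))
    (hZ.contMDiffAt hW hx), h x (hWV hx) _ (hZt x hx), hZ0.mvfderiv_eq, mvfderiv_const]
  simp

theorem isInfAut_field (hV : IsOpen V) (v : EuclideanSpace ℝ (Fin m)) :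
    𝓕.IsInfAut V (A.field v) := by
  refine A.isInfAut hV (A.isSmoothField_field v) fun x hx w _ ↦ ?_
  have h : (fun y ↦ mvfderiv (𝓡 m) A.h y (A.field v y)) =ᶠ[nhds x] fun _ ↦ A.slope v := by
    filter_upwards [hV.mem_nhds hx] with y hy using A.mvfderiv_field v y hy
  rw [h.mvfderiv_eq, mvfderiv_const]
  rfl

/-- The vector fields of the frame which project to the coordinate vectors of the transverse
model. -/
def transverse (j : Fin q) : Π x : M, TangentSpace (𝓡 m) x :=
  A.field (A.slope_surjective (EuclideanSpace.single j 1)).choose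

theorem mvfderiv_transverse (j : Fin q) {y : M} (hy : y ∈ V) :
    mvfderiv (𝓡 m) A.h y (A.transverse j y) = EuclideanSpace.single j 1 :=
  (A.mvfderiv_field _ y hy).trans (A.slope_surjective (EuclideanSpace.single j 1)).choose_spec

theorem isInfAut_transverse (hV : IsOpen V) (j : Fin q) : 𝓕.IsInfAut V (A.transverse j) :=
  A.isInfAut_field hV _

theorem mvfderiv_sum_smul_transverse (c : EuclideanSpace ℝ (Fin q)) {y : M} (hy : y ∈ V) :
    mvfderiv (𝓡 m) A.h y (∑ j, c j • A.transverse j y) = c := by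
  rw [map_sum]
  simp only [map_smul, A.mvfderiv_transverse _ hy]
  ext k
  simp [Pi.single_apply]

theorem sum_smul_proj_transverse (c : EuclideanSpace ℝ (Fin q)) (y : M) :
    ∑ j, c j • 𝓕.proj (A.transverse j) y = (𝓕.tangent y).mkQ (∑ j, c j • A.transverse j y) := by
  simp only [map_sum, map_smul]
  rfl

theorem sum_smul_proj_transverse_eq {y : M} (hy : y ∈ V) (Y : Π x : M, TangentSpace (𝓡 m) x) :
    ∑ j, mvfderiv (𝓡 m) A.h y (Y y) j • 𝓕.proj (A.transverse j) y = 𝓕.proj Y y := by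
  rw [A.sum_smul_proj_transverse]
  refine (Submodule.Quotient.eq _).2 ((A.mem_tangent_iff y hy _).2 ?_)
  rw [map_sub, A.mvfderiv_sum_smul_transverse _ hy, sub_self]

theorem eq_zero_of_sum_smul_proj_transverse_eq_zero {c : EuclideanSpace ℝ (Fin q)} {y : M}
    (hy : y ∈ V) (hc : ∑ j, c j • 𝓕.proj (A.transverse j) y = 0) : c = 0 := by
  rw [A.sum_smul_proj_transverse] at hc
  rw [← A.mvfderiv_sum_smul_transverse c hy]
  exact (A.mem_tangent_iff y hy _).1 ((Submodule.Quotient.mk_eq_zero _).1 hc)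

end AdaptedFrame

variable [IsManifold (𝓡 q) ∞ N₀]

theorem exists_adaptedFrame_subset (𝓕 : FoliationCocycle m q M N₀ ι) {U : Set M} (hU : IsOpen U)
    {x : M} (hx : x ∈ U) :
    ∃ V : Set M, IsOpen V ∧ x ∈ V ∧ V ⊆ U ∧ Nonempty (𝓕.AdaptedFrame V) := by
  obtain ⟨V, hV, hxV, ⟨A⟩⟩ := 𝓕.exists_adaptedFrame x
  exact ⟨V ∩ U, hV.inter hU, ⟨hxV, hx⟩, Set.inter_subset_right, ⟨A.restrict Set.inter_subset_left⟩⟩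

theorem exists_isInfAut_eq (𝓕 : FoliationCocycle m q M N₀ ι) {U : Set M} (hU : IsOpen U)
    {x : M} (hx : x ∈ U) (v : TangentSpace (𝓡 m) x) :
    ∃ V : Set M, IsOpen V ∧ x ∈ V ∧ V ⊆ U ∧ ∃ X, 𝓕.IsInfAut V X ∧ X x = v := by
  obtain ⟨V, hV, hxV, hVU, ⟨A⟩⟩ := 𝓕.exists_adaptedFrame_subset hU hx
  obtain ⟨w, hw⟩ := A.exists_field_eq x hxV v
  exact ⟨V, hV, hxV, hVU, A.field w, A.isInfAut_field hV w, hw⟩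

/-- Near `x` a smooth section is a combination, with smooth coefficients, of the classes of the
transverse frame fields. This is the tool for extending identities from infinitesimal automorphisms
to all smooth sections. -/
theorem IsSmoothSection.induction_at {x : M} {P : (Π y : M, 𝓕.Normal y) → Prop}
    (congr : ∀ V : Set M, IsOpen V → x ∈ V → ∀ σ τ, 𝓕.IsSmoothSection V σ →
      (∀ y ∈ V, τ y = σ y) → P σ → P τ)
    (add : ∀ V : Set M, IsOpen V → x ∈ V → ∀ σ τ, 𝓕.IsSmoothSection V σ →
      𝓕.IsSmoothSection V τ → P σ → P τ → P (fun y ↦ σ y + τ y))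
    (smul : ∀ V : Set M, IsOpen V → x ∈ V → ∀ (φ : M → ℝ) σ,
      ContMDiffOn (𝓡 m) 𝓘(ℝ, ℝ) ∞ φ V → 𝓕.IsSmoothSection V σ → P σ → P (fun y ↦ φ y • σ y))
    (infAut : ∀ V : Set M, IsOpen V → x ∈ V → ∀ X, 𝓕.IsInfAut V X → P (𝓕.proj X))
    {U : Set M} {σ : Π y : M, 𝓕.Normal y} (hσ : 𝓕.IsSmoothSection U σ) (hx : x ∈ U) : P σ := by
  obtain ⟨W, hW, hxW, hWU, Y, hY, hσY⟩ := hσ x hx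
  obtain ⟨V, hV, hxV, hVW, ⟨A⟩⟩ := 𝓕.exists_adaptedFrame_subset hW hxW
  have hb := (hY.mono hVW).contMDiffOn_mvfderiv hV A.contMDiffOn_h
  have hbj : ∀ j, ContMDiffOn (𝓡 m) 𝓘(ℝ, ℝ) ∞ (fun y ↦ mvfderiv (𝓡 m) A.h y (Y y) j) V := fun j ↦
    (EuclideanSpace.proj (𝕜 := ℝ) j).contMDiff.comp_contMDiffOn hb
  have hE : ∀ j, 𝓕.IsSmoothSection V (𝓕.proj (A.transverse j)) := fun j ↦
    isSmoothSection_proj hV (A.isInfAut_transverse hV j).1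
  have hsum : ∀ s : Finset (Fin q),
      𝓕.IsSmoothSection V
        (fun y ↦ ∑ j ∈ s, mvfderiv (𝓡 m) A.h y (Y y) j • 𝓕.proj (A.transverse j) y) ∧
      P (fun y ↦ ∑ j ∈ s, mvfderiv (𝓡 m) A.h y (Y y) j • 𝓕.proj (A.transverse j) y) := by
    intro s
    induction s using Finset.induction_on with
    | empty =>
      -- The zero section is obtained as zero times the class of an infinitesimal automorphism.
      have h0 := smul V hV hxV (fun _ ↦ 0) _ contMDiffOn_const
        (isSmoothSection_proj hV (A.isSmoothField_field 0))
        (infAut V hV hxV _ (A.isInfAut_field hV 0))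
      have h1 := IsSmoothSection.smul (φ := fun _ ↦ 0) contMDiffOn_const
        (isSmoothSection_proj (𝓕 := 𝓕) hV (A.isSmoothField_field 0))
      simp only [zero_smul] at h0 h1
      simpa only [Finset.sum_empty] using ⟨h1, h0⟩
    | insert j s hj ih =>
      simp only [Finset.sum_insert hj]
      have h := (hE j).smul (hbj j)
      exact ⟨h.add ih.1, add V hV hxV _ _ h ih.1 (smul V hV hxV _ _ (hbj j) (hE j)
        (infAut V hV hxV _ (A.isInfAut_transverse hV j))) ih.2⟩
  refine congr V hV hxV _ _ (hsum Finset.univ).1 (fun y hy ↦ ?_) (hsum Finset.univ).2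
  rw [hσY y (hVW hy), A.sum_smul_proj_transverse_eq hy]

end FoliationCocycle
end

/-! ### Duality for arbitrary smooth sections, and curvature. -/

section

variable {m q : ℕ} {M : Type*} [TopologicalSpace M] [ChartedSpace (EuclideanSpace ℝ (Fin m)) M]
  [IsManifold (𝓡 m) ∞ M]
  {N₀ : Type*} [TopologicalSpace N₀] [ChartedSpace (EuclideanSpace ℝ (Fin q)) N₀] {ι : Type*}

namespace FoliationCocycle

variable {𝓕 : FoliationCocycle m q M N₀ ι}

/-- A connection is a local operator. -/
theorem NormalConnection.toFun_congr (D : 𝓕.NormalConnection) {U : Set M} (hU : IsOpen U)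
    {σ τ : Π x : M, 𝓕.Normal x} (hσ : 𝓕.IsSmoothSection U σ) (h : ∀ y ∈ U, τ y = σ y) {x : M}
    (hx : x ∈ U) : D.toFun τ x = D.toFun σ x := by
  classical
  -- The indicator serves as a cutoff: the Leibniz rule on `U` only asks for smoothness on `U`,
  -- where `φ` is constant, while `φ • τ` and `φ • σ` agree on all of `M`.
  let φ : M → ℝ := U.indicator 1
  have hφ1 : ∀ y ∈ U, φ y = 1 := fun y hy ↦ Set.indicator_of_mem hy 1
  have hφ : ContMDiffOn (𝓡 m) 𝓘(ℝ, ℝ) ∞ φ U := contMDiffOn_const.congr hφ1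
  have hdφ : mvfderiv (𝓡 m) φ x = 0 := by
    have h1 : φ =ᶠ[nhds x] fun _ ↦ 1 := by
      filter_upwards [hU.mem_nhds hx] with y hy using hφ1 y hy
    rw [h1.mvfderiv_eq, mvfderiv_const]
  have heq : (fun y ↦ φ y • τ y) = fun y ↦ φ y • σ y := by
    funext y
    by_cases hy : y ∈ U
    · rw [h y hy]
    · simp [φ, hy]
  ext v
  have h1 := D.leibniz U hU φ τ hφ (hσ.congr h) x hx v
  have h2 := D.leibniz U hU φ σ hφ hσ x hx v
  rw [heq] at h1
  simpa [hφ1 x hx, hdφ] using h1.symm.trans h2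

theorem NormalMetric.ext_left (g : 𝓕.NormalMetric) {x : M} {u v : 𝓕.Normal x}
    (h : ∀ w, g.inner x u w = g.inner x v w) : u = v := by
  by_contra huv
  have h1 := g.pos x (u - v) (sub_ne_zero.2 huv)
  rw [map_sub (g.inner x), LinearMap.sub_apply, h, sub_self] at h1
  exact lt_irrefl _ h1

theorem NormalMetric.ext_right (g : 𝓕.NormalMetric) {x : M} {u v : 𝓕.Normal x}
    (h : ∀ w, g.inner x w u = g.inner x w v) : u = v :=
  g.ext_left fun w ↦ by rw [g.symm, h, g.symm]

theorem NormalMetric.mdifferentiableAt (g : 𝓕.NormalMetric) {U : Set M} (hU : IsOpen U)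
    {σ τ : Π x : M, 𝓕.Normal x} (hσ : 𝓕.IsSmoothSection U σ) (hτ : 𝓕.IsSmoothSection U τ) {x : M}
    (hx : x ∈ U) :
    MDifferentiableAt (𝓡 m) 𝓘(ℝ, ℝ) (fun y ↦ g.inner y (σ y) (τ y)) x :=
  ((g.smooth U hU σ τ hσ hτ).contMDiffAt (hU.mem_nhds hx)).mdifferentiableAt (by simp)

theorem NormalMetric.mvfderiv_add (g : 𝓕.NormalMetric) {U : Set M} (hU : IsOpen U)
    {σ σ' τ : Π x : M, 𝓕.Normal x} (hσ : 𝓕.IsSmoothSection U σ) (hσ' : 𝓕.IsSmoothSection U σ')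
    (hτ : 𝓕.IsSmoothSection U τ) {x : M} (hx : x ∈ U) (v : TangentSpace (𝓡 m) x) :
    mvfderiv (𝓡 m) (fun y ↦ g.inner y (σ y + σ' y) (τ y)) x v =
      mvfderiv (𝓡 m) (fun y ↦ g.inner y (σ y) (τ y)) x v +
        mvfderiv (𝓡 m) (fun y ↦ g.inner y (σ' y) (τ y)) x v := by
  simp only [map_add, LinearMap.add_apply]
  rw [mvfderiv_fun_add (g.mdifferentiableAt hU hσ hτ hx) (g.mdifferentiableAt hU hσ' hτ hx)]
  rfl

theorem NormalMetric.mvfderiv_smul (g : 𝓕.NormalMetric) {U : Set M} (hU : IsOpen U)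
    {φ : M → ℝ} {σ τ : Π x : M, 𝓕.Normal x} (hφ : ContMDiffOn (𝓡 m) 𝓘(ℝ, ℝ) ∞ φ U)
    (hσ : 𝓕.IsSmoothSection U σ)
    (hτ : 𝓕.IsSmoothSection U τ) {x : M} (hx : x ∈ U) (v : TangentSpace (𝓡 m) x) :
    mvfderiv (𝓡 m) (fun y ↦ g.inner y (φ y • σ y) (τ y)) x v =
      φ x * mvfderiv (𝓡 m) (fun y ↦ g.inner y (σ y) (τ y)) x v +
        g.inner x (σ x) (τ x) * mvfderiv (𝓡 m) φ x v := by
  simp only [map_smul, LinearMap.smul_apply, smul_eq_mul]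
  rw [mvfderiv_fun_mul ((hφ.contMDiffAt (hU.mem_nhds hx)).mdifferentiableAt (by simp))
    (g.mdifferentiableAt hU hσ hτ hx)]
  rfl

theorem NormalMetric.mvfderiv_congr (g : 𝓕.NormalMetric) {U : Set M} (hU : IsOpen U)
    {σ σ' τ : Π x : M, 𝓕.Normal x} (h : ∀ y ∈ U, σ' y = σ y) {x : M} (hx : x ∈ U) :
    mvfderiv (𝓡 m) (fun y ↦ g.inner y (σ' y) (τ y)) x =
      mvfderiv (𝓡 m) (fun y ↦ g.inner y (σ y) (τ y)) x := by
  refine Filter.EventuallyEq.mvfderiv_eq ?_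
  filter_upwards [hU.mem_nhds hx] with y hy
  rw [h y hy]

variable {g : 𝓕.NormalMetric} {D D' : 𝓕.NormalConnection}

theorem IsDual.symm (h : IsDual g D D') : IsDual g D' D := by
  intro U hU X Y Z hX hY hZ x hx
  have h1 := h U hU X Z Y hX hZ hY x hx
  simp only [NormalMetric.lieDeriv] at h1 ⊢
  simp only [g.symm _ (𝓕.proj Y _)]
  rw [h1, g.symm x (𝓕.proj Z x), add_comm]

variable [IsManifold (𝓡 q) ∞ N₀]

/-- The slots are freed one at a time. In the base case of the induction on `σ`, the vector `v` is
extended to an infinitesimal automorphism. -/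
theorem IsDual.mvfderiv_inner_proj (h : IsDual g D D') {U : Set M} (hU : IsOpen U)
    {σ : Π x : M, 𝓕.Normal x} {Z : Π x : M, TangentSpace (𝓡 m) x} (hσ : 𝓕.IsSmoothSection U σ)
    (hZ : 𝓕.IsInfAut U Z) {x : M} (hx : x ∈ U) (v : TangentSpace (𝓡 m) x) :
    mvfderiv (𝓡 m) (fun y ↦ g.inner y (σ y) (𝓕.proj Z y)) x v =
      g.inner x (D.toFun σ x v) (𝓕.proj Z x) + g.inner x (σ x) (D'.toFun (𝓕.proj Z) x v) := by
  have hZs := isSmoothSection_proj (𝓕 := 𝓕) hU hZ.1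
  refine IsSmoothSection.induction_at (x := x) (P := fun σ ↦
    mvfderiv (𝓡 m) (fun y ↦ g.inner y (σ y) (𝓕.proj Z y)) x v =
      g.inner x (D.toFun σ x v) (𝓕.proj Z x) + g.inner x (σ x) (D'.toFun (𝓕.proj Z) x v))
    ?_ ?_ ?_ ?_ hσ hx
  · intro V hV hxV σ τ hσ hτ ih
    rw [g.mvfderiv_congr hV hτ hxV, D.toFun_congr hV hσ hτ hxV, hτ x hxV, ih]
  · intro V hV hxV σ τ hσ hτ ih1 ih2
    have hW := hV.inter hU
    rw [g.mvfderiv_add hW (hσ.mono hW Set.inter_subset_left) (hτ.mono hW Set.inter_subset_left)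
      (hZs.mono hW Set.inter_subset_right) ⟨hxV, hx⟩, ih1, ih2, D.add V hV σ τ hσ hτ x hxV]
    simp only [LinearMap.add_apply, map_add]
    ring
  · intro V hV hxV φ σ hφ hσ ih
    have hW := hV.inter hU
    rw [g.mvfderiv_smul hW (hφ.mono Set.inter_subset_left) (hσ.mono hW Set.inter_subset_left)
      (hZs.mono hW Set.inter_subset_right) ⟨hxV, hx⟩, ih, D.leibniz V hV φ σ hφ hσ x hxV]
    simp only [LinearMap.add_apply, LinearMap.smul_apply, map_add, map_smul, smul_eq_mul]
    ring
  · intro V hV hxV Y hY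
    obtain ⟨W, hW, hxW, hWV, X, hX, rfl⟩ := 𝓕.exists_isInfAut_eq (hV.inter hU) ⟨hxV, hx⟩ v
    exact h W hW X Y Z hX (hY.mono (hWV.trans Set.inter_subset_left))
      (hZ.mono (hWV.trans Set.inter_subset_right)) x hxW

/-- The duality relation holds for all smooth sections and all tangent vectors. -/
theorem IsDual.mvfderiv_inner (h : IsDual g D D') {U : Set M} (hU : IsOpen U)
    {σ τ : Π x : M, 𝓕.Normal x} (hσ : 𝓕.IsSmoothSection U σ) (hτ : 𝓕.IsSmoothSection U τ)
    {x : M} (hx : x ∈ U) (v : TangentSpace (𝓡 m) x) :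
    mvfderiv (𝓡 m) (fun y ↦ g.inner y (σ y) (τ y)) x v =
      g.inner x (D.toFun σ x v) (τ x) + g.inner x (σ x) (D'.toFun τ x v) := by
  -- Symmetry of `g` moves `τ` to the first slot, where the sum and product rules are available.
  simp only [g.symm _ (σ _)]
  rw [g.symm _ (D.toFun σ x v)]
  refine IsSmoothSection.induction_at (x := x) (P := fun τ ↦
    mvfderiv (𝓡 m) (fun y ↦ g.inner y (τ y) (σ y)) x v =
      g.inner x (τ x) (D.toFun σ x v) + g.inner x (D'.toFun τ x v) (σ x))
    ?_ ?_ ?_ ?_ hτ hx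
  · intro V hV hxV τ τ' hτ hτ' ih
    rw [g.mvfderiv_congr hV hτ' hxV, D'.toFun_congr hV hτ hτ' hxV, hτ' x hxV, ih]
  · intro V hV hxV τ τ' hτ hτ' ih1 ih2
    have hW := hV.inter hU
    rw [g.mvfderiv_add hW (hτ.mono hW Set.inter_subset_left) (hτ'.mono hW Set.inter_subset_left)
      (hσ.mono hW Set.inter_subset_right) ⟨hxV, hx⟩, ih1, ih2, D'.add V hV τ τ' hτ hτ' x hxV]
    simp only [LinearMap.add_apply, map_add]
    ring
  · intro V hV hxV φ τ hφ hτ ih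
    have hW := hV.inter hU
    rw [g.mvfderiv_smul hW (hφ.mono Set.inter_subset_left) (hτ.mono hW Set.inter_subset_left)
      (hσ.mono hW Set.inter_subset_right) ⟨hxV, hx⟩, ih, D'.leibniz V hV φ τ hφ hτ x hxV]
    simp only [LinearMap.add_apply, LinearMap.smul_apply, map_add, map_smul, smul_eq_mul]
    ring
  · intro V hV hxV Z hZ
    have hW := hV.inter hU
    have h1 := h.mvfderiv_inner_proj hW (hσ.mono hW Set.inter_subset_right)
      (hZ.mono Set.inter_subset_left) ⟨hxV, hx⟩ v
    simp only [g.symm _ (σ _)] at h1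
    rw [h1, g.symm x (𝓕.proj Z x), add_comm]

/-- The curvature tensors of dual connections are opposite up to transposition. -/
theorem IsDual.inner_curvature_add (h : IsDual g D D') {U : Set M} (hU : IsOpen U)
    {X Y : Π x : M, TangentSpace (𝓡 m) x} {σ τ : Π x : M, 𝓕.Normal x} (hX : IsSmoothField U X)
    (hY : IsSmoothField U Y) (hσ : 𝓕.IsSmoothSection U σ) (hτ : 𝓕.IsSmoothSection U τ) {x : M}
    (hx : x ∈ U) :
    g.inner x (D.curvature X Y σ x) (τ x) + g.inner x (σ x) (D'.curvature X Y τ x) = 0 := by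
  -- Two applications of duality. The sum of the two mixed terms is invariant under exchanging `X`
  -- and `Y`.
  have second : ∀ {X Y : Π x : M, TangentSpace (𝓡 m) x}, IsSmoothField U X → IsSmoothField U Y →
      mvfderiv (𝓡 m) (fun y ↦ mvfderiv (𝓡 m) (fun z ↦ g.inner z (σ z) (τ z)) y (Y y)) x (X x) =
        g.inner x (D.deriv X (D.deriv Y σ) x) (τ x) + g.inner x (D.deriv Y σ x) (D'.deriv X τ x) +
        (g.inner x (D.deriv X σ x) (D'.deriv Y τ x) +
          g.inner x (σ x) (D'.deriv X (D'.deriv Y τ) x)) := by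
    intro X Y hX hY
    have hDσ : 𝓕.IsSmoothSection U (D.deriv Y σ) := D.smooth U hU Y σ hY hσ
    have hDτ : 𝓕.IsSmoothSection U (D'.deriv Y τ) := D'.smooth U hU Y τ hY hτ
    have heq : (fun y ↦ mvfderiv (𝓡 m) (fun z ↦ g.inner z (σ z) (τ z)) y (Y y)) =ᶠ[nhds x]
        fun y ↦ g.inner y (D.deriv Y σ y) (τ y) + g.inner y (σ y) (D'.deriv Y τ y) := by
      filter_upwards [hU.mem_nhds hx] with y hy using h.mvfderiv_inner hU hσ hτ hy _
    rw [heq.mvfderiv_eq, mvfderiv_fun_add (g.mdifferentiableAt hU hDσ hτ hx)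
      (g.mdifferentiableAt hU hσ hDτ hx), add_apply,
      h.mvfderiv_inner hU hDσ hτ hx, h.mvfderiv_inner hU hσ hDτ hx]
    rfl
  have hb := mvfderiv_mlieBracket_apply ((g.smooth U hU σ τ hσ hτ).contMDiffAt (hU.mem_nhds hx))
    (hX.contMDiffAt hU hx) (hY.contMDiffAt hU hx)
  rw [second hX hY, second hY hX, h.mvfderiv_inner hU hσ hτ hx] at hb
  simp only [NormalConnection.curvature, map_sub, LinearMap.sub_apply]
  simp only [NormalConnection.deriv] at hb ⊢
  linarith

/-- The endomorphism `ζ ↦ c (g(Y, ζ) X - g(X, ζ) Y)` is skew for `g`, hence equal to minus its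
transpose, which is what Part 1 assigns to `D'`. -/
theorem IsDual.hasConstantCurvature (h : IsDual g D D') {c : ℝ}
    (hc : HasConstantCurvature D g c) : HasConstantCurvature D' g c := by
  intro U hU X Y ζ hX hY hζ x hx
  refine g.ext_right fun w ↦ ?_
  obtain ⟨w, rfl⟩ := Submodule.mkQ_surjective _ w
  obtain ⟨V, hV, hxV, hVU, W, hW, rfl⟩ := 𝓕.exists_isInfAut_eq hU hx w
  change g.inner x (𝓕.proj W x) _ = g.inner x (𝓕.proj W x) _
  have hWs := isSmoothSection_proj (𝓕 := 𝓕) hV hW.1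
  have h1 := h.inner_curvature_add hV (hX.mono hVU) (hY.mono hVU) hWs (hζ.mono hV hVU) hxV
  rw [hc V hV X Y _ (hX.mono hVU) (hY.mono hVU) hWs x hxV] at h1
  simp only [map_sub, map_smul, LinearMap.sub_apply, LinearMap.smul_apply, smul_eq_mul] at h1 ⊢
  rw [g.symm x (𝓕.proj W x) (𝓕.proj X x), g.symm x (𝓕.proj W x) (𝓕.proj Y x)]
  linarith

end FoliationCocycle
end

/-! ### The dual connection is again a foliated Codazzi structure. -/

section

theorem mvfderiv_fun_sum_apply {E H M F κ : Type*} [NormedAddCommGroup E] [NormedSpace ℝ E]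
    [TopologicalSpace H] {I : ModelWithCorners ℝ E H} [TopologicalSpace M] [ChartedSpace H M]
    [NormedAddCommGroup F] [NormedSpace ℝ F] {f : κ → M → F} {x : M} (s : Finset κ)
    (hf : ∀ j, MDifferentiableAt I 𝓘(ℝ, F) (f j) x) (v : TangentSpace I x) :
    mvfderiv I (fun y ↦ ∑ j ∈ s, f j y) x v = ∑ j ∈ s, mvfderiv I (f j) x v := by
  classical
  have h : MDifferentiableAt I 𝓘(ℝ, F) (fun y ↦ ∑ j ∈ s, f j y) x ∧
      mvfderiv I (fun y ↦ ∑ j ∈ s, f j y) x v = ∑ j ∈ s, mvfderiv I (f j) x v := by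
    induction s using Finset.induction_on with
    | empty => exact ⟨by simpa using mdifferentiableAt_const, by simp [mvfderiv_const]⟩
    | insert j s hj ih =>
      simp only [Finset.sum_insert hj]
      refine ⟨(hf j).add ih.1, ?_⟩
      rw [mvfderiv_fun_add (hf j) ih.1, add_apply, ih.2]
  exact h.2

variable {m q : ℕ} {M : Type*} [TopologicalSpace M] [ChartedSpace (EuclideanSpace ℝ (Fin m)) M]
  [IsManifold (𝓡 m) ∞ M]
  {N₀ : Type*} [TopologicalSpace N₀] [ChartedSpace (EuclideanSpace ℝ (Fin q)) N₀]
  [IsManifold (𝓡 q) ∞ N₀] {ι : Type*}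

namespace FoliationCocycle

variable {𝓕 : FoliationCocycle m q M N₀ ι} {g : 𝓕.NormalMetric} {D D' : 𝓕.NormalConnection}

theorem IsDual.derivMetric_eq (h : IsDual g D D') {U : Set M} (hU : IsOpen U)
    {X : Π x : M, TangentSpace (𝓡 m) x} {σ τ : Π x : M, 𝓕.Normal x}
    (hσ : 𝓕.IsSmoothSection U σ) (hτ : 𝓕.IsSmoothSection U τ) {x : M} (hx : x ∈ U) :
    D.derivMetric g X σ τ x = g.inner x (D'.deriv X σ x - D.deriv X σ x) (τ x) := by
  have h1 := h.symm.mvfderiv_inner hU hσ hτ hx (X x)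
  simp only [NormalConnection.derivMetric, NormalMetric.lieDeriv, NormalConnection.deriv, map_sub,
    LinearMap.sub_apply]
  rw [h1]
  ring

/-- The difference of two dual connections is symmetric with respect to the metric. -/
theorem IsDual.inner_sub (h : IsDual g D D') {U : Set M} (hU : IsOpen U)
    {σ τ : Π x : M, 𝓕.Normal x} (hσ : 𝓕.IsSmoothSection U σ) (hτ : 𝓕.IsSmoothSection U τ) {x : M}
    (hx : x ∈ U) (v : TangentSpace (𝓡 m) x) :
    g.inner x (D'.toFun σ x v - D.toFun σ x v) (τ x) =
      g.inner x (σ x) (D'.toFun τ x v - D.toFun τ x v) := by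
  have h1 := h.mvfderiv_inner hU hσ hτ hx v
  have h2 := h.symm.mvfderiv_inner hU hσ hτ hx v
  simp only [map_sub, LinearMap.sub_apply]
  linarith

/-- The difference of two dual connections is a tensor. -/
theorem IsDual.sub_congr (h : IsDual g D D') {U : Set M} (hU : IsOpen U)
    {σ σ' : Π x : M, 𝓕.Normal x} (hσ : 𝓕.IsSmoothSection U σ) (hσ' : 𝓕.IsSmoothSection U σ')
    {x : M} (hx : x ∈ U) (hσσ' : σ x = σ' x) (v : TangentSpace (𝓡 m) x) :
    D'.toFun σ x v - D.toFun σ x v = D'.toFun σ' x v - D.toFun σ' x v := by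
  refine g.ext_left fun w ↦ ?_
  obtain ⟨w, rfl⟩ := Submodule.mkQ_surjective _ w
  obtain ⟨V, hV, hxV, hVU, W, hW, rfl⟩ := 𝓕.exists_isInfAut_eq hU hx w
  have hWs := isSmoothSection_proj (𝓕 := 𝓕) hV hW.1
  -- Moving the difference operator onto `W` leaves an expression in which `σ` enters only through
  -- its value at `x`.
  exact (h.inner_sub hV (hσ.mono hV hVU) hWs hxV v).trans
    ((congrArg (fun u ↦ g.inner x u _) hσσ').trans
      (h.inner_sub hV (hσ'.mono hV hVU) hWs hxV v).symm)

/-- For infinitesimal automorphisms this is the Codazzi equation rewritten by `derivMetric_eq`;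
tensoriality lets `X` and `Y` be replaced by infinitesimal automorphisms with the same values at
`x`. -/
theorem IsDual.sub_comm (h : IsDual g D D') (hD : D.SatisfiesCodazzi g) {U : Set M}
    (hU : IsOpen U) {X Y : Π x : M, TangentSpace (𝓡 m) x} (hX : IsSmoothField U X)
    (hY : IsSmoothField U Y) {x : M} (hx : x ∈ U) :
    D'.deriv X (𝓕.proj Y) x - D.deriv X (𝓕.proj Y) x =
      D'.deriv Y (𝓕.proj X) x - D.deriv Y (𝓕.proj X) x := by
  obtain ⟨V, hV, hxV, hVU, X₁, hX₁, hXx⟩ := 𝓕.exists_isInfAut_eq hU hx (X x)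
  obtain ⟨V', hV', hxV', hVV', Y₁, hY₁, hYx⟩ := 𝓕.exists_isInfAut_eq hV hxV (Y x)
  have hX₁' := hX₁.mono hVV'
  have hU' := hVV'.trans hVU
  have hsX := isSmoothSection_proj (𝓕 := 𝓕) hV' (hX.mono hU')
  have hsY := isSmoothSection_proj (𝓕 := 𝓕) hV' (hY.mono hU')
  have hsX₁ := isSmoothSection_proj (𝓕 := 𝓕) hV' hX₁'.1
  have hsY₁ := isSmoothSection_proj (𝓕 := 𝓕) hV' hY₁.1
  have h1 := h.sub_congr hV' hsY hsY₁ hxV' (congrArg (𝓕.tangent x).mkQ hYx.symm) (X x)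
  have h2 := h.sub_congr hV' hsX hsX₁ hxV' (congrArg (𝓕.tangent x).mkQ hXx.symm) (Y x)
  simp only [NormalConnection.deriv]
  rw [h1, h2, ← hXx, ← hYx]
  refine g.ext_left fun w ↦ ?_
  obtain ⟨w, rfl⟩ := Submodule.mkQ_surjective _ w
  obtain ⟨W, hW, hxW, hWV, Z, hZ, rfl⟩ := 𝓕.exists_isInfAut_eq hV' hxV' w
  have hsZ := isSmoothSection_proj (𝓕 := 𝓕) hW hZ.1
  have h3 := hD W hW X₁ Y₁ (𝓕.proj Z) (hX₁'.mono hWV) (hY₁.mono hWV) (hZ.isFoliatedSection hW) x hxW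
  rw [h.derivMetric_eq hW (hsY₁.mono hW hWV) hsZ hxW,
    h.derivMetric_eq hW (hsX₁.mono hW hWV) hsZ hxW] at h3
  exact h3

theorem IsDual.isTorsionFree (h : IsDual g D D') (hD : D.SatisfiesCodazzi g)
    (ht : D.IsTorsionFree) : D'.IsTorsionFree := by
  intro U hU X Y hX hY x hx
  rw [← ht U hU X Y hX hY x hx, sub_eq_sub_iff_sub_eq_sub]
  exact h.sub_comm hD hU hX hY hx

theorem IsDual.satisfiesCodazzi (h : IsDual g D D') (hD : D.SatisfiesCodazzi g) :
    D'.SatisfiesCodazzi g := by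
  intro U hU X Y ζ hX hY hζ x hx
  rw [h.symm.derivMetric_eq hU (isSmoothSection_proj hU hY.1) hζ.isSmoothSection hx,
    h.symm.derivMetric_eq hU (isSmoothSection_proj hU hX.1) hζ.isSmoothSection hx,
    ← neg_sub (D'.deriv X _ x), ← neg_sub (D'.deriv Y _ x), h.sub_comm hD hU hX.1 hY.1 hx]

/-- A frame field has constant slope, so being tangent to the leaves at `x` forces slope zero and
tangency on all of `V`. -/
theorem exists_tangent_field_eq (𝓕 : FoliationCocycle m q M N₀ ι) {U : Set M} (hU : IsOpen U)
    {x : M} (hx : x ∈ U) {v : TangentSpace (𝓡 m) x} (hv : v ∈ 𝓕.tangent x) :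
    ∃ V : Set M, IsOpen V ∧ x ∈ V ∧ V ⊆ U ∧ ∃ Z, IsSmoothField V Z ∧
      (∀ y ∈ V, Z y ∈ 𝓕.tangent y) ∧ Z x = v := by
  obtain ⟨V, hV, hxV, hVU, ⟨A⟩⟩ := 𝓕.exists_adaptedFrame_subset hU hx
  obtain ⟨w, rfl⟩ := A.exists_field_eq x hxV v
  refine ⟨V, hV, hxV, hVU, A.field w, A.isSmoothField_field w, fun y hy ↦ ?_, rfl⟩
  rw [A.mem_tangent_iff x hxV, A.mvfderiv_field w x hxV] at hv
  rw [A.mem_tangent_iff y hy, A.mvfderiv_field w y hy, hv]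

theorem NormalMetric.IsFoliated.mvfderiv_eq_zero (hg : g.IsFoliated) {U : Set M} (hU : IsOpen U)
    {σ τ : Π x : M, 𝓕.Normal x} (hσ : 𝓕.IsFoliatedSection U σ) (hτ : 𝓕.IsFoliatedSection U τ)
    {x : M} (hx : x ∈ U) {v : TangentSpace (𝓡 m) x} (hv : v ∈ 𝓕.tangent x) :
    mvfderiv (𝓡 m) (fun y ↦ g.inner y (σ y) (τ y)) x v = 0 := by
  obtain ⟨V, hV, hxV, hVU, Z, hZ, hZt, rfl⟩ := 𝓕.exists_tangent_field_eq hU hx hv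
  exact hg V hV Z σ τ hZ hZt (hσ.mono hV hVU) (hτ.mono hV hVU) x hxV

/-- Infinitesimal automorphisms preserve the functions which are constant along the leaves. -/
theorem IsInfAut.mvfderiv_mvfderiv_eq_zero {U : Set M} (hU : IsOpen U)
    {X : Π x : M, TangentSpace (𝓡 m) x} (hX : 𝓕.IsInfAut U X) {f : M → ℝ}
    (hf : ContMDiffOn (𝓡 m) 𝓘(ℝ, ℝ) ∞ f U)
    (hf' : ∀ y ∈ U, ∀ v ∈ 𝓕.tangent y, mvfderiv (𝓡 m) f y v = 0) {x : M} (hx : x ∈ U)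
    {v : TangentSpace (𝓡 m) x} (hv : v ∈ 𝓕.tangent x) :
    mvfderiv (𝓡 m) (fun y ↦ mvfderiv (𝓡 m) f y (X y)) x v = 0 := by
  obtain ⟨V, hV, hxV, hVU, Z, hZ, hZt, rfl⟩ := 𝓕.exists_tangent_field_eq hU hx hv
  have h1 := mvfderiv_mlieBracket_apply (hf.contMDiffAt (hU.mem_nhds hx)) (hX.1.contMDiffAt hU hx)
    (hZ.contMDiffAt hV hxV)
  have h2 : (fun y ↦ mvfderiv (𝓡 m) f y (Z y)) =ᶠ[nhds x] fun _ ↦ 0 := by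
    filter_upwards [hV.mem_nhds hxV] with y hy using hf' y (hVU hy) _ (hZt y hy)
  -- Both `[X, Z]f` and `X(Zf)` vanish, leaving `Z(Xf) = 0`.
  rw [hf' x hx _ (hX.2 V hV hVU Z hZ hZt x hxV), h2.mvfderiv_eq, mvfderiv_const] at h1
  simpa using h1

/-- A section is foliated if its scalar products with foliated sections are constant along the
leaves. -/
theorem NormalMetric.IsFoliated.isFoliatedSection (hg : g.IsFoliated) {U : Set M}
    {ρ : Π x : M, 𝓕.Normal x} (hρ : 𝓕.IsSmoothSection U ρ)
    (h : ∀ V : Set M, IsOpen V → V ⊆ U → ∀ ζ, 𝓕.IsFoliatedSection V ζ → ∀ x ∈ V,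
      ∀ v ∈ 𝓕.tangent x, mvfderiv (𝓡 m) (fun y ↦ g.inner y (ρ y) (ζ y)) x v = 0) :
    𝓕.IsFoliatedSection U ρ := by
  intro x₀ hx₀
  obtain ⟨W, hW, hxW, hWU, Y, hY, hρY⟩ := hρ x₀ hx₀
  obtain ⟨V, hV, hxV, hVW, ⟨A⟩⟩ := 𝓕.exists_adaptedFrame_subset hW hxW
  refine ⟨V, hV, hxV, hVW.trans hWU, Y, A.isInfAut hV (hY.mono hVW) fun x hx v hv ↦ ?_,
    fun y hy ↦ hρY y (hVW hy)⟩
  have hb := (hY.mono hVW).contMDiffOn_mvfderiv hV A.contMDiffOn_h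
  set b : M → EuclideanSpace ℝ (Fin q) := fun y ↦ mvfderiv (𝓡 m) A.h y (Y y) with hbdef
  have hbx := (hb.contMDiffAt (hV.mem_nhds hx)).mdifferentiableAt (by simp)
  have hE := fun j ↦ (A.isInfAut_transverse hV j).isFoliatedSection hV
  have hbj : ∀ j, MDifferentiableAt (𝓡 m) 𝓘(ℝ, ℝ) (fun y ↦ b y j) x := fun j ↦
    ((EuclideanSpace.proj (𝕜 := ℝ) j).contMDiff.contMDiffAt.mdifferentiableAt one_ne_zero).comp x hbx
  have hdbj : ∀ j, mvfderiv (𝓡 m) (fun y ↦ b y j) x v = mvfderiv (𝓡 m) b x v j := by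
    intro j
    have h1 := mvfderiv_comp_apply_of_mdifferentiableAt
      ((EuclideanSpace.proj (𝕜 := ℝ) j).contMDiff.contMDiffAt.mdifferentiableAt one_ne_zero) hbx v
    refine h1.trans ((mvfderiv_vectorSpace_apply _ _ _).trans ?_)
    rw [ContinuousLinearMap.fderiv]
    rfl
  -- Let `E_j` be the classes of the transverse fields. Differentiate `g(ρ, E_k) = ∑ b_j g(E_j,
  -- E_k)` along the leaf: the functions `g(E_j, E_k)` have zero derivative as `g` is foliated, so
  -- only the derivatives of the `b_j` survive.
  have key : ∀ k, g.inner x (∑ j, mvfderiv (𝓡 m) b x v j • 𝓕.proj (A.transverse j) x)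
      (𝓕.proj (A.transverse k) x) = 0 := by
    intro k
    have h1 := h V hV (hVW.trans hWU) _ (hE k) x hx v hv
    have h2 : (fun y ↦ g.inner y (ρ y) (𝓕.proj (A.transverse k) y)) =ᶠ[nhds x] fun y ↦
        ∑ j, b y j * g.inner y (𝓕.proj (A.transverse j) y) (𝓕.proj (A.transverse k) y) := by
      filter_upwards [hV.mem_nhds hx] with y hy
      rw [hρY y (hVW hy), ← A.sum_smul_proj_transverse_eq hy]
      simp only [map_sum, map_smul, LinearMap.sum_apply, LinearMap.smul_apply, smul_eq_mul]
      rfl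
    have hgj : ∀ j, MDifferentiableAt (𝓡 m) 𝓘(ℝ, ℝ)
        (fun y ↦ g.inner y (𝓕.proj (A.transverse j) y) (𝓕.proj (A.transverse k) y)) x := fun j ↦
      g.mdifferentiableAt hV (hE j).isSmoothSection (hE k).isSmoothSection hx
    rw [h2.mvfderiv_eq, mvfderiv_fun_sum_apply (f := fun j y ↦ b y j *
      g.inner y (𝓕.proj (A.transverse j) y) (𝓕.proj (A.transverse k) y)) _
      fun j ↦ (hbj j).mul (hgj j)] at h1
    rw [← h1]
    simp only [map_sum, map_smul, LinearMap.sum_apply, LinearMap.smul_apply, smul_eq_mul]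
    refine Finset.sum_congr rfl fun j _ ↦ ?_
    rw [mvfderiv_fun_mul (hbj j) (hgj j), ← hdbj, add_apply, smul_apply,
      smul_apply, hg.mvfderiv_eq_zero hV (hE j) (hE k) hx hv]
    simp [mul_comm]
  refine A.eq_zero_of_sum_smul_proj_transverse_eq_zero hx ?_
  -- Being orthogonal to every `E_k`, the combination is orthogonal to itself.
  by_contra hne
  refine (g.pos x _ hne).ne' ?_
  rw [map_sum (g.inner x _)]
  refine Finset.sum_eq_zero fun k _ ↦ ?_
  rw [map_smul, key k, smul_zero]

/-- In `g(D'_X σ, ζ) = X g(σ, ζ) - g(σ, D_X ζ)` both terms are constant along the leaves: the first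
because `X` preserves such functions, the second because `D_X ζ` is foliated. -/
theorem IsDual.isFoliated (h : IsDual g D D') (hD : D.IsFoliated) (hg : g.IsFoliated) :
    D'.IsFoliated := by
  intro U hU X σ hX hσ
  have hρ : 𝓕.IsSmoothSection U (D'.deriv X σ) := D'.smooth U hU X σ hX.1 hσ.isSmoothSection
  refine hg.isFoliatedSection hρ fun V hV hVU ζ hζ x hx v hv ↦ ?_
  have hσV := hσ.mono hV hVU
  have hXV := hX.mono hVU
  have hDζ := hD V hV X ζ hXV hζ
  have hsm := g.smooth V hV σ ζ hσV.isSmoothSection hζ.isSmoothSection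
  have heq : (fun y ↦ g.inner y (D'.deriv X σ y) (ζ y)) =ᶠ[nhds x] fun y ↦
      mvfderiv (𝓡 m) (fun z ↦ g.inner z (σ z) (ζ z)) y (X y) -
        g.inner y (σ y) (D.deriv X ζ y) := by
    filter_upwards [hV.mem_nhds hx] with y hy
    rw [h.symm.mvfderiv_inner hV hσV.isSmoothSection hζ.isSmoothSection hy]
    exact (add_sub_cancel_right _ _).symm
  rw [heq.mvfderiv_eq, mvfderiv_fun_sub
    (((hXV.1.contMDiffOn_mvfderiv hV hsm).contMDiffAt (hV.mem_nhds hx)).mdifferentiableAt (by simp))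
    (g.mdifferentiableAt hV hσV.isSmoothSection hDζ.isSmoothSection hx), sub_apply,
    hXV.mvfderiv_mvfderiv_eq_zero hV hsm
      (fun y hy w hw ↦ hg.mvfderiv_eq_zero hV hσV hζ hy hw) hx hv,
    hg.mvfderiv_eq_zero hV hσV hDζ hx hv, sub_zero]

theorem IsDual.isFoliatedCodazzi (h : IsDual g D D') (hD : IsFoliatedCodazzi D g) :
    IsFoliatedCodazzi D' g where
  torsionFree := h.isTorsionFree hD.codazzi hD.torsionFree
  codazzi := h.satisfiesCodazzi hD.codazzi
  foliated_connection := h.isFoliated hD.foliated_connection hD.foliated_metric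
  foliated_metric := hD.foliated_metric

end FoliationCocycle
end

end

theorem mainTheorem5 {m q : ℕ} {M : Type*} [TopologicalSpace M] [T2Space M]
    [SecondCountableTopology M] [ChartedSpace (EuclideanSpace ℝ (Fin m)) M] [IsManifold (𝓡 m) ∞ M]
    {N₀ : Type*} [TopologicalSpace N₀] [ChartedSpace (EuclideanSpace ℝ (Fin q)) N₀]
    [IsManifold (𝓡 q) ∞ N₀] {ι : Type*} (𝓕 : FoliationCocycle m q M N₀ ι)
    (g : 𝓕.NormalMetric) (D D' : 𝓕.NormalConnection)
    (hD : FoliationCocycle.IsFoliatedCodazzi D g) (hD' : FoliationCocycle.IsDual g D D') :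
    (∀ U : Set M, IsOpen U →
      ∀ (X Y : Π x : M, TangentSpace (𝓡 m) x) (Z W : Π x : M, 𝓕.Normal x),
        IsSmoothField U X → IsSmoothField U Y →
        𝓕.IsSmoothSection U Z → 𝓕.IsSmoothSection U W → ∀ x ∈ U,
          g.inner x (D.curvature X Y Z x) (W x) + g.inner x (Z x) (D'.curvature X Y W x) = 0) ∧
    (∀ c : ℝ, FoliationCocycle.HasConstantCurvature D g c →
      FoliationCocycle.IsFoliatedCodazzi D' g ∧ FoliationCocycle.HasConstantCurvature D' g c) :=
  ⟨fun _ hU _ _ _ _ hX hY hZ hW _ hx ↦ hD'.inner_curvature_add hU hX hY hZ hW hx,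
    fun _ hc ↦ ⟨hD'.isFoliatedCodazzi hD, hD'.hasConstantCurvature hc⟩⟩
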